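/- Let $n\ge 0$, $E=\{0,1,\dots,n\}$, and let $M$ be a matroid on $E$. A matroid $M'$ on $E$ is a *quotient* of $M$, written $f:M'\twoheadleftarrow M$, if every flat of $M'$ is a flat of $M$; put $n_f(S)=\operatorname{rk}_M(S)-\operatorname{rk}_{M'}(S)$ for $S\subseteq E$. An *$f$-cyclic flat* is a flat $F$ of $M'$ that is minimal under inclusion among the flats $G$ of $M'$ with $n_f(G)=n_f(F)$. The quotient $M'$ is a *relative nested quotient* of $M$ if its $f$-cyclic flats form a chain. Let $\Sigma_{A_n}$ be the braid fan in $N_{\mathbb R}=\mathbb R^E/\mathbb R(1,\dots,1)$, whose $\ell$-dimensional cones are $\operatorname{Cone}(u_{S_1},\dots,u_{S_\ell})$, one for each chain $\emptyset\subsetneq S_1\subsetneq\cdots\subsetneq S_\ell\subsetneq E$, where $u_S$ is the image of the indicator vector of $S$. Let $\operatorname{MW}_\ell(\Sigma_{A_n})$ be the real vector space of functions $\Delta:\Sigma_{A_n}(\ell)\to\mathbb R$ on the set of $\ell$-dimensional cones that satisfy, for every $(\ell-1)$-dimensional cone $\tau$, $\sum_{\sigma\succ\tau}\Delta(\sigma)\,u_{\sigma\setminus\tau}\in\operatorname{span}_{\mathbb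 R}(\tau)$, where $\sigma$ runs over the $\ell$-dimensional cones containing $\tau$ as a face and $u_{\sigma\setminus\tau}$ is the ray vector of $\sigma$ not in $\tau$. Put $\operatorname{MW}_\bullet(\Sigma_{A_n})=\bigoplus_\ell\operatorname{MW}_\ell(\Sigma_{A_n})$. For a loopless matroid $M'$ on $E$ of rank $d+1$, its *Bergman class* $\Delta_{M'}\in\operatorname{MW}_d(\Sigma_{A_n})$ takes the value $1$ on $\operatorname{Cone}(u_{S_1},\dots,u_{S_d})$ if $S_1,\dots,S_d$ are all flats of $M'$, and $0$ otherwise. Then the family of Bergman classes $\Delta_{M'}$, indexed by the loopless relative nested quotients $M'$ of $M$, is linearly independent in $\operatorname{MW}_\bullet(\Sigma_{A_n})$. -/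

import Mathlib

/-! ### Matroid quotients -/

/-- `M'` is a matroid quotient of `M`: both have the same ground set, and every flat of `M'` is a
flat of `M`. -/
structure Matroid.IsQuotientOf {E : Type*} (M' M : Matroid E) : Prop where
  ground_eq : M'.E = M.E
  isFlat_of_isFlat : ∀ F : Set E, M'.IsFlat F → M.IsFlat F

/-- The rank function with values in `ℕ` (only used on finite ground sets). -/
noncomputable def Matroid.natRk {E : Type*} (M : Matroid E) (S : Set E) : ℕ :=
  (M.eRk S).toNat

/-- The nullity `n_f(S) = rk_M(S) - rk_{M'}(S)` of a quotient `f : M' ↞ M`. -/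
noncomputable def Matroid.quotNullity {E : Type*} (M' M : Matroid E) (S : Set E) : ℤ :=
  (M.natRk S : ℤ) - (M'.natRk S : ℤ)

/-- `F` is an `f`-cyclic flat of `f : M' ↞ M`: a flat of `M'` that is minimal for inclusion among
the flats `G` of `M'` with `n_f(G) = n_f(F)`. -/
def Matroid.IsQuotCyclicFlat {E : Type*} (M' M : Matroid E) (F : Set E) : Prop :=
  Minimal (fun G : Set E => M'.IsFlat G ∧ M'.quotNullity M G = M'.quotNullity M F) F

/-- `M'` is a relative nested quotient of `M`: a quotient whose `f`-cyclic flats form a chain. -/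
structure Matroid.IsRelativeNestedQuotientOf {E : Type*} (M' M : Matroid E) : Prop where
  isQuotientOf : M'.IsQuotientOf M
  isChain_cyclicFlats : IsChain (· ⊆ ·) {F : Set E | M'.IsQuotCyclicFlat M F}

/-! ### The braid fan and its Minkowski weights -/

section BraidFan

variable (E : Type*) [Fintype E] [DecidableEq E]

/-- The real vector space `N_ℝ = ℝ^E / ℝ (1, …, 1)` in which the braid fan lives. -/
abbrev BraidSpace : Type _ := (E → ℝ) ⧸ Submodule.span ℝ {(fun _ => 1 : E → ℝ)}

variable {E} in
/-- The vector `u_S` in `N_ℝ`: the image of the indicator vector `e_S` of `S`. For nonempty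
proper `S` these are the primitive ray vectors of the braid fan. -/
noncomputable def braidRay (S : Finset E) : BraidSpace E :=
  Submodule.Quotient.mk (fun i => if i ∈ S then 1 else 0)

/-- The `ℓ`-dimensional cones `Cone(u_{S_1}, …, u_{S_ℓ})` of the braid fan, one for each chain
`∅ ⊊ S_1 ⊊ ⋯ ⊊ S_ℓ ⊊ E`; a cone is given by the set `{S_1, …, S_ℓ}` that indexes its rays, and
the face relation is inclusion of these sets. -/
@[ext] structure BraidCone (ℓ : ℕ) where
  rays : Finset (Finset E)
  card_rays : rays.card = ℓ
  proper : ∀ S ∈ rays, S ≠ ∅ ∧ S ≠ Finset.univ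
  isChain : IsChain (· ⊆ ·) (rays : Set (Finset E))

noncomputable instance (ℓ : ℕ) : Fintype (BraidCone E ℓ) :=
  Fintype.ofInjective BraidCone.rays fun _ _ h => BraidCone.ext h

/-- The space `MW_ℓ` of `ℓ`-dimensional real Minkowski weights on the braid fan: functions `Δ` on
the `ℓ`-dimensional cones such that for every `(ℓ-1)`-dimensional cone `τ` the sum of
`Δ(σ) u_{σ∖τ}` over the `ℓ`-dimensional cones `σ` containing `τ` lies in the span of `τ`.
(For such `σ` the set `σ ∖ τ` has exactly one element, so the inner sum is `u_{σ∖τ}`.) -/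
def MinkowskiWeight (ℓ : ℕ) : Submodule ℝ (BraidCone E ℓ → ℝ) where
  carrier := {Δ | ∀ (k : ℕ), k + 1 = ℓ → ∀ τ : BraidCone E k,
    ∑ σ : BraidCone E ℓ with τ.rays ⊆ σ.rays, Δ σ • ∑ S ∈ σ.rays \ τ.rays, braidRay S
      ∈ Submodule.span ℝ (braidRay '' (τ.rays : Set (Finset E)))}
  zero_mem' := by
    intro k _ τ
    simp
  add_mem' := by
    intro a b ha hb k hk τ
    simpa [add_smul, Finset.sum_add_distrib] using
      Submodule.add_mem _ (ha k hk τ) (hb k hk τ)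
  smul_mem' := by
    intro c a ha k hk τ
    simpa [mul_smul, Finset.smul_sum] using Submodule.smul_mem _ c (ha k hk τ)

/-- The graded space `MW_• = ⨁_ℓ MW_ℓ` of Minkowski weights on the braid fan. -/
abbrev MinkowskiWeights : Type _ := DirectSum ℕ fun ℓ => MinkowskiWeight E ℓ

end BraidFan

/-! ### Bergman classes -/

/-- Loopless matroids with ground set all of `E`. -/
structure LooplessMatroid (E : Type*) where
  toMatroid : Matroid E
  ground_eq : toMatroid.E = Set.univ
  loopless : toMatroid.Loopless

/-- The function on `ℓ`-dimensional cones of the braid fan that is `1` on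
`Cone(u_{S_1}, …, u_{S_ℓ})` if all of `S_1, …, S_ℓ` are flats of `M`, and `0` otherwise. -/
noncomputable def bergmanWeight {E : Type*} [Fintype E] [DecidableEq E] (M : Matroid E) (ℓ : ℕ)
    (σ : BraidCone E ℓ) : ℝ :=
  open Classical in if ∀ S ∈ σ.rays, M.IsFlat (S : Set E) then 1 else 0

theorem coe_natRk {E : Type*} [Finite E] (M : Matroid E) (S : Set E) : (M.natRk S : ℕ∞) = M.eRk S := by
  refine ENat.natCast_toNat ?_
  have h := M.eRk_le_encard S
  have h2 : S.encard ≠ ⊤ := by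
    rw [Set.encard_ne_top_iff]
    exact Set.toFinite S
  exact ne_top_of_le_ne_top h2 h

theorem natRk_mono {E : Type*} [Finite E] (M : Matroid E) {S T : Set E} (h : S ⊆ T) : M.natRk S ≤ M.natRk T := by
  have := M.eRk_mono h
  rw [← coe_natRk, ← coe_natRk] at this
  exact_mod_cast this

theorem natRk_insert {E : Type*} [Finite E] (M : Matroid E) (hE : M.E = Set.univ) {A : Set E} (hA : M.IsFlat A) {x : E}
    (hx : x ∉ A) : M.natRk (insert x A) = M.natRk A + 1 := by
  have := M.eRk_insert_eq_add_one (e := x) (X := A) ⟨by simp [hE], by rwa [hA.closure]⟩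
  rw [← coe_natRk, ← coe_natRk] at this
  exact_mod_cast this

theorem natRk_lt {E : Type*} [Finite E] (M : Matroid E) (hE : M.E = Set.univ) {A B : Set E} (hA : M.IsFlat A)
    (h : A ⊂ B) : M.natRk A < M.natRk B := by
  obtain ⟨x, hxB, hxA⟩ := Set.exists_of_ssubset h
  have h1 := natRk_insert M hE hA hxA
  have h2 := natRk_mono M (Set.insert_subset hxB h.subset)
  omega

theorem natRk_closure {E : Type*} (M : Matroid E) (A : Set E) : M.natRk (M.closure A) = M.natRk A := by
  simp [Matroid.natRk]

theorem eq_of_natRk_le {E : Type*} [Finite E] (M : Matroid E) (hE : M.E = Set.univ) {A B : Set E} (hA : M.IsFlat A)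
    (h : A ⊆ B) (hr : M.natRk B ≤ M.natRk A) : A = B := by
  by_contra hne
  exact absurd (natRk_lt M hE hA (lt_of_le_of_ne h hne)) (by omega)

/-- In a chain of flats, the rank determines the order. -/
theorem ssubset_of_natRk_lt {E : Type*} [Finite E] (M : Matroid E) {A B : Finset E}
    (h : A ⊆ B ∨ B ⊆ A) (hr : M.natRk (A : Set E) < M.natRk (B : Set E)) : A ⊂ B := by
  rcases h with h | h
  · refine lt_of_le_of_ne h ?_
    rintro rfl
    omega
  · have := natRk_mono M (Finset.coe_subset.2 h)
    omega

/-- A chain of `rk M` flats that contains `∅` and `E` misses exactly one rank `m`; it contains flats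
`A` and `B` of ranks `m - 1` and `m + 1`. -/
theorem exists_gap {E : Type*} [Fintype E] (M : Matroid E) (hE : M.E = Set.univ)
    (C : Finset (Finset E)) (hC : IsChain (· ⊆ ·) (C : Set (Finset E)))
    (hF : ∀ S ∈ C, M.IsFlat (S : Set E)) (h0 : ∅ ∈ C) (h1 : Finset.univ ∈ C)
    (hcard : C.card = M.natRk Set.univ) :
    ∃ m, (∀ S ∈ C, M.natRk (S : Set E) ≠ m) ∧
      (∀ j, j ≤ M.natRk Set.univ → j ≠ m → ∃ S ∈ C, M.natRk (S : Set E) = j) ∧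
      0 < m ∧ m < M.natRk Set.univ := by
  classical
  set R := M.natRk Set.univ with hR
  let f : Finset E → ℕ := fun S => M.natRk (S : Set E)
  have hinj : Set.InjOn f C := by
    intro S hS T hT hST
    have key : ∀ S ∈ C, ∀ T, f S = f T → S ⊆ T → S = T := fun S hS T hST h =>
      Finset.coe_injective (eq_of_natRk_le M hE (hF S hS) (Finset.coe_subset.2 h) hST.ge)
    rcases hC.total hS hT with h | h
    · exact key S hS T hST h
    · exact (key T hT S hST.symm h).symm
  have hsub : C.image f ⊆ Finset.range (R + 1) := by
    intro j hj
    obtain ⟨S, -, rfl⟩ := Finset.mem_image.1 hj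
    exact Finset.mem_range.2 (Nat.lt_succ_of_le (natRk_mono M (Set.subset_univ _)))
  have hc : (Finset.range (R + 1) \ C.image f).card = 1 := by
    rw [Finset.card_sdiff_of_subset hsub, Finset.card_image_of_injOn hinj, hcard]
    simp
  obtain ⟨m, hm⟩ := Finset.card_eq_one.1 hc
  have hmem : ∀ j, (j < R + 1 ∧ ∀ S ∈ C, f S ≠ j) ↔ j = m := by
    intro j
    have := congrArg (j ∈ ·) hm
    simpa using this
  have hmm := (hmem m).2 rfl
  have hm0 : m ≠ 0 := by
    have := hmm.2 ∅ h0
    intro h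
    apply this
    simp [f, h, Matroid.natRk]
  have hmR : m ≠ R := by
    have := hmm.2 _ h1
    intro h
    apply this
    simp [f, h, hR]
  refine ⟨m, hmm.2, ?_, by omega, by omega⟩
  intro j hj hjm
  by_contra hcon
  push Not at hcon
  exact hjm ((hmem j).1 ⟨by omega, hcon⟩)

theorem braidRay_empty {E : Type*} [DecidableEq E] : braidRay (∅ : Finset E) = 0 := by
  rw [braidRay, Submodule.Quotient.mk_eq_zero]
  convert Submodule.zero_mem _
  simp

theorem braidRay_univ {E : Type*} [Fintype E] [DecidableEq E] : braidRay (Finset.univ : Finset E) = 0 := by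
  rw [braidRay, Submodule.Quotient.mk_eq_zero]
  refine Submodule.subset_span ?_
  simp

/-- The flats strictly between flats `A ⊂ B` with `rk B = rk A + 2` partition `B ∖ A`. -/
theorem sum_braidRay_between {E : Type*} [DecidableEq E] [Fintype E] (M : Matroid E) (hE : M.E = Set.univ) (A B : Finset E)
    (hA : M.IsFlat (A : Set E)) (hB : M.IsFlat (B : Set E)) (hAB : A ⊆ B)
    (hr : M.natRk (B : Set E) = M.natRk (A : Set E) + 2) (𝒢 : Finset (Finset E))
    (h𝒢 : ∀ G, G ∈ 𝒢 ↔ M.IsFlat (G : Set E) ∧ A ⊂ G ∧ G ⊂ B) :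
    ∑ G ∈ 𝒢, braidRay G = ((𝒢.card : ℝ) - 1) • braidRay A + braidRay B := by
  classical
  have hrk : ∀ G ∈ 𝒢, M.natRk (G : Set E) = M.natRk (A : Set E) + 1 := by
    intro G hG
    obtain ⟨h1, h2, h3⟩ := (h𝒢 G).1 hG
    have := natRk_lt M hE hA (Finset.coe_ssubset.2 h2)
    have := natRk_lt M hE h1 (Finset.coe_ssubset.2 h3)
    omega
  have hfun : ∑ G ∈ 𝒢, (fun i => if i ∈ G then (1 : ℝ) else 0 : E → ℝ) =
      ((𝒢.card : ℝ) - 1) • (fun i => if i ∈ A then (1 : ℝ) else 0 : E → ℝ) +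
        (fun i => if i ∈ B then (1 : ℝ) else 0 : E → ℝ) := by
    funext x
    simp only [Finset.sum_apply, Pi.add_apply, Pi.smul_apply, smul_eq_mul]
    by_cases hxA : x ∈ A
    · have : ∀ G ∈ 𝒢, (if x ∈ G then (1 : ℝ) else 0) = 1 := fun G hG =>
        if_pos (((h𝒢 G).1 hG).2.1.subset hxA)
      rw [Finset.sum_congr rfl this, if_pos hxA, if_pos (hAB hxA)]
      simp
    by_cases hxB : x ∈ B
    · rw [if_neg hxA, if_pos hxB]
      obtain ⟨G₀, hG₀⟩ : ∃ G₀ : Finset E, (G₀ : Set E) = M.closure (insert x (A : Set E)) :=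
        ⟨(M.closure (insert x (A : Set E))).toFinset, by simp⟩
      have hfl : M.IsFlat (G₀ : Set E) := by
        rw [hG₀]
        exact M.isFlat_closure _
      have hins : insert x (A : Set E) ⊆ G₀ := by
        rw [hG₀]
        exact M.subset_closure _ (by simp [hE])
      have hr0 : M.natRk (G₀ : Set E) = M.natRk (A : Set E) + 1 := by
        rw [hG₀, natRk_closure, natRk_insert M hE hA (by simpa using hxA)]
      have hxG : x ∈ G₀ := by
        have := hins (Set.mem_insert _ _)
        simpa using this
      have hAG : A ⊆ G₀ := Finset.coe_subset.1 ((Set.subset_insert _ _).trans hins)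
      have hG₀B : G₀ ⊆ B := by
        rw [← Finset.coe_subset, hG₀]
        refine hB.closure ▸ M.closure_subset_closure ?_
        exact Set.insert_subset (by simpa using hxB) (Finset.coe_subset.2 hAB)
      have hmem : G₀ ∈ 𝒢 := by
        refine (h𝒢 _).2 ⟨hfl, ssubset_of_natRk_lt M (Or.inl hAG) (by omega),
          ssubset_of_natRk_lt M (Or.inl hG₀B) (by omega)⟩
      rw [Finset.sum_eq_single G₀]
      · simp [hxG]
      · intro G hG hne
        refine if_neg fun hxG' => hne ?_
        obtain ⟨g1, g2, g3⟩ := (h𝒢 G).1 hG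
        have hsub : (G₀ : Set E) ⊆ G := by
          rw [hG₀]
          refine g1.closure ▸ M.closure_subset_closure ?_
          exact Set.insert_subset (by simpa using hxG') (Finset.coe_subset.2 g2.subset)
        have := eq_of_natRk_le M hE hfl hsub (by rw [hrk G hG, hr0])
        exact (Finset.coe_injective this).symm
      · exact fun h => absurd hmem h
    · rw [if_neg hxA, if_neg hxB]
      have : ∀ G ∈ 𝒢, (if x ∈ G then (1 : ℝ) else 0) = 0 := fun G hG =>
        if_neg fun h => hxB (((h𝒢 G).1 hG).2.2.subset h)
      rw [Finset.sum_congr rfl this]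
      simp
  have := congrArg (Submodule.mkQ (Submodule.span ℝ {(fun _ => 1 : E → ℝ)})) hfun
  simpa [map_sum, map_add, map_smul, braidRay] using this

/-- The Bergman weight of a loopless matroid of rank `d + 1` satisfies the balancing condition. -/
theorem bergmanWeight_mem {E : Type*} [Fintype E] [DecidableEq E] (M : LooplessMatroid E) :
    bergmanWeight M.toMatroid (M.toMatroid.natRk Set.univ - 1) ∈
      MinkowskiWeight E (M.toMatroid.natRk Set.univ - 1) := by
  classical
  obtain ⟨M, hE, hM⟩ := M
  dsimp only
  intro k hk τ
  by_cases hτ : ∀ S ∈ τ.rays, M.IsFlat (S : Set E)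
  swap
  · rw [Finset.sum_eq_zero]
    · exact Submodule.zero_mem _
    · intro σ hσ
      have hσ' : τ.rays ⊆ σ.rays := by simpa using hσ
      have : ¬ ∀ S ∈ σ.rays, M.IsFlat (S : Set E) := fun h => hτ fun S hS => h S (hσ' hS)
      simp [bergmanWeight, this]
  have hR : M.natRk Set.univ = k + 2 := by omega
  have hne : (∅ : Finset E) ≠ Finset.univ := by
    intro h
    have : M.natRk ((Finset.univ : Finset E) : Set E) = 0 := by
      rw [← h]
      simp [Matroid.natRk]
    rw [Finset.coe_univ] at this
    omega
  have hτ0 : ∅ ∉ τ.rays := fun h => (τ.proper _ h).1 rfl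
  have hτ1 : Finset.univ ∉ τ.rays := fun h => (τ.proper _ h).2 rfl
  have hflat : ∀ S ∈ insert ∅ (insert Finset.univ τ.rays), M.IsFlat ((S : Finset E) : Set E) := by
    intro S hS
    rcases Finset.mem_insert.1 hS with rfl | hS
    · rw [Finset.coe_empty, Matroid.isFlat_iff_closure_eq]
      exact M.loops_eq_empty
    rcases Finset.mem_insert.1 hS with rfl | hS
    · rw [Finset.coe_univ, ← hE]
      exact M.ground_isFlat
    · exact hτ S hS
  have hspan : ∀ S ∈ insert ∅ (insert Finset.univ τ.rays),
      braidRay S ∈ Submodule.span ℝ (braidRay '' (τ.rays : Set (Finset E))) := by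
    intro S hS
    rcases Finset.mem_insert.1 hS with rfl | hS
    · rw [braidRay_empty]
      exact Submodule.zero_mem _
    rcases Finset.mem_insert.1 hS with rfl | hS
    · rw [braidRay_univ]
      exact Submodule.zero_mem _
    · exact Submodule.subset_span ⟨S, hS, rfl⟩
  have hchain : ∀ S ∈ insert ∅ (insert Finset.univ τ.rays),
      ∀ T ∈ insert ∅ (insert Finset.univ τ.rays), S ⊆ T ∨ T ⊆ S := by
    intro S hS T hT
    rcases Finset.mem_insert.1 hS with rfl | hS
    · exact Or.inl (Finset.empty_subset _)
    rcases Finset.mem_insert.1 hS with rfl | hS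
    · exact Or.inr (Finset.subset_univ _)
    rcases Finset.mem_insert.1 hT with rfl | hT
    · exact Or.inr (Finset.empty_subset _)
    rcases Finset.mem_insert.1 hT with rfl | hT
    · exact Or.inl (Finset.subset_univ _)
    exact τ.isChain.total hS hT
  obtain ⟨m, hm, hm', hm0, hmR⟩ := exists_gap M hE (insert ∅ (insert Finset.univ τ.rays))
    (fun S hS T hT _ => hchain S hS T hT) hflat (by simp) (by simp)
    (by
      rw [Finset.card_insert_of_notMem (by simp [hne, hτ0]), Finset.card_insert_of_notMem hτ1,
        τ.card_rays, hR])
  obtain ⟨A, hAC, hAr⟩ := hm' (m - 1) (by omega) (by omega)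
  obtain ⟨B, hBC, hBr⟩ := hm' (m + 1) (by omega) (by omega)
  have hAB : A ⊂ B := ssubset_of_natRk_lt M (hchain A hAC B hBC) (by omega)
  set 𝒢 : Finset (Finset E) :=
    Finset.univ.filter fun G => M.IsFlat (G : Set E) ∧ A ⊂ G ∧ G ⊂ B with h𝒢
  have h𝒢' : ∀ G, G ∈ 𝒢 ↔ M.IsFlat (G : Set E) ∧ A ⊂ G ∧ G ⊂ B := by simp [h𝒢]
  have hrk : ∀ G ∈ 𝒢, M.natRk (G : Set E) = m := by
    intro G hG
    obtain ⟨h1, h2, h3⟩ := (h𝒢' G).1 hG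
    have := natRk_lt M hE (hflat A hAC) (Finset.coe_ssubset.2 h2)
    have := natRk_lt M hE h1 (Finset.coe_ssubset.2 h3)
    omega
  have hnot : ∀ G ∈ 𝒢, G ∉ τ.rays := fun G hG h => hm G (by simp [h]) (hrk G hG)
  have hcone : ∀ G ∈ 𝒢, (insert G τ.rays).card = M.natRk Set.univ - 1 ∧
      (∀ S ∈ insert G τ.rays, S ≠ ∅ ∧ S ≠ Finset.univ) ∧
      IsChain (· ⊆ ·) ((insert G τ.rays : Finset (Finset E)) : Set (Finset E)) := by
    intro G hG
    obtain ⟨h1, h2, h3⟩ := (h𝒢' G).1 hG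
    refine ⟨?_, ?_, ?_⟩
    · rw [Finset.card_insert_of_notMem (hnot G hG), τ.card_rays, hk]
    · intro S hS
      rcases Finset.mem_insert.1 hS with rfl | hS
      · refine ⟨?_, ?_⟩
        · rintro rfl
          exact hm ∅ (by simp) (hrk _ hG)
        · rintro rfl
          exact hm Finset.univ (by simp) (hrk _ hG)
      · exact τ.proper S hS
    · rw [Finset.coe_insert]
      refine IsChain.insert τ.isChain ?_
      intro S hS _
      have hSC : S ∈ insert ∅ (insert Finset.univ τ.rays) := by
        simp [Finset.mem_coe.1 hS]
      have hSm := hm S hSC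
      rcases lt_or_gt_of_ne hSm with hlt | hgt
      · right
        refine subset_trans ?_ h2.subset
        rcases hchain S hSC A hAC with h | h
        · exact h
        · have := eq_of_natRk_le M hE (hflat A hAC) (Finset.coe_subset.2 h) (by omega)
          exact (Finset.coe_injective this).ge
      · left
        refine subset_trans h3.subset ?_
        rcases hchain B hBC S hSC with h | h
        · exact h
        · have := eq_of_natRk_le M hE (hflat S hSC) (Finset.coe_subset.2 h) (by omega)
          exact (Finset.coe_injective this).ge
  have hsum : ∑ σ : BraidCone E (M.natRk Set.univ - 1) with τ.rays ⊆ σ.rays,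
      bergmanWeight M (M.natRk Set.univ - 1) σ • ∑ S ∈ σ.rays \ τ.rays, braidRay S =
      ∑ G ∈ 𝒢, braidRay G := by
    symm
    have hinsert : ∀ G ∈ 𝒢, insert G τ.rays \ τ.rays = {G} := by
      intro G hG
      ext S
      simp only [Finset.mem_sdiff, Finset.mem_insert, Finset.mem_singleton]
      constructor
      · rintro ⟨h | h, h'⟩
        · exact h
        · exact absurd h h'
      · rintro rfl
        exact ⟨Or.inl rfl, hnot _ hG⟩
    have hw : ∀ σ : BraidCone E (M.natRk Set.univ - 1),
        bergmanWeight M (M.natRk Set.univ - 1) σ • ∑ S ∈ σ.rays \ τ.rays, braidRay S =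
        if ∀ S ∈ σ.rays, M.IsFlat (S : Set E) then ∑ S ∈ σ.rays \ τ.rays, braidRay S else 0 := by
      intro σ
      unfold bergmanWeight
      split_ifs <;> simp
    rw [Finset.sum_congr rfl fun σ _ => hw σ, ← Finset.sum_filter]
    refine Finset.sum_bij (fun G hG => ⟨insert G τ.rays, (hcone G hG).1, (hcone G hG).2.1, (hcone G hG).2.2⟩) ?_ ?_ ?_ ?_
    · intro G hG
      simp only [Finset.mem_filter, Finset.mem_univ, true_and]
      refine ⟨Finset.subset_insert _ _, ?_⟩
      intro S hS
      rcases Finset.mem_insert.1 hS with rfl | hS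
      · exact ((h𝒢' _).1 hG).1
      · exact hτ S hS
    · intro G hG G' hG' h
      have h1 : insert G τ.rays = insert G' τ.rays := congrArg BraidCone.rays h
      have h2 := hinsert G hG
      rw [h1, hinsert G' hG'] at h2
      exact (Finset.singleton_injective h2).symm
    · intro σ hσ
      simp only [Finset.mem_filter, Finset.mem_univ, true_and] at hσ
      obtain ⟨hτσ, hσF⟩ := hσ
      have hc : (σ.rays \ τ.rays).card = 1 := by
        rw [Finset.card_sdiff_of_subset hτσ, σ.card_rays, τ.card_rays]
        omega
      obtain ⟨G, hG⟩ := Finset.card_eq_one.1 hc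
      have hGm : G ∈ σ.rays \ τ.rays := by simp [hG]
      have hGσ := (Finset.mem_sdiff.1 hGm).1
      have hGτ := (Finset.mem_sdiff.1 hGm).2
      have hσeq : insert G τ.rays = σ.rays := by
        rw [Finset.insert_eq, ← hG, Finset.sdiff_union_of_subset hτσ]
      have hGF := hσF G hGσ
      have hcmp : ∀ S ∈ insert ∅ (insert Finset.univ τ.rays), S ⊆ G ∨ G ⊆ S := by
        intro S hS
        rcases Finset.mem_insert.1 hS with rfl | hS
        · exact Or.inl (Finset.empty_subset _)
        rcases Finset.mem_insert.1 hS with rfl | hS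
        · exact Or.inr (Finset.subset_univ _)
        · exact σ.isChain.total (hτσ hS) hGσ
      have hGr : M.natRk (G : Set E) = m := by
        by_contra hcon
        obtain ⟨S, hS, hSr⟩ := hm' _ (natRk_mono M (Set.subset_univ (G : Set E))) hcon
        have hSG : S = G := by
          rcases hcmp S hS with h | h
          · exact Finset.coe_injective
              (eq_of_natRk_le M hE (hflat S hS) (Finset.coe_subset.2 h) hSr.ge)
          · exact (Finset.coe_injective
              (eq_of_natRk_le M hE hGF (Finset.coe_subset.2 h) hSr.le)).symm
        subst hSG
        rcases Finset.mem_insert.1 hS with h | hS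
        · exact (σ.proper _ hGσ).1 h
        rcases Finset.mem_insert.1 hS with h | hS
        · exact (σ.proper _ hGσ).2 h
        · exact hGτ hS
      refine ⟨G, (h𝒢' G).2 ⟨hGF, ssubset_of_natRk_lt M (hcmp A hAC) (by omega),
        ssubset_of_natRk_lt M (hcmp B hBC).symm (by omega)⟩, BraidCone.ext hσeq⟩
    · intro G hG
      simp only [hinsert G hG, Finset.sum_singleton]
  rw [hsum, sum_braidRay_between M hE A B (hflat A hAC) (hflat B hBC) hAB.subset (by omega) 𝒢 h𝒢']
  exact Submodule.add_mem _ (Submodule.smul_mem _ _ (hspan A hAC)) (hspan B hBC)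

/-- The Bergman class `Δ_M` of a loopless matroid `M` of rank `d + 1`, a `d`-dimensional Minkowski
weight on the braid fan, as an element of `MW_•`. -/
noncomputable def bergmanClass {E : Type*} [Fintype E] [DecidableEq E]
    (M : LooplessMatroid E) : MinkowskiWeights E :=
  DirectSum.lof ℝ ℕ (fun ℓ => MinkowskiWeight E ℓ) (M.toMatroid.natRk Set.univ - 1)
    ⟨bergmanWeight M.toMatroid (M.toMatroid.natRk Set.univ - 1), bergmanWeight_mem M⟩

/-! The family is triangular for the pointwise order on rank functions. For a relative nested
quotient `N` of `M`, the `f`-cyclic flats form a chain, so they lie on a complete flag of flats of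
`N` (`exists_flag_of_isChain`); let `σ` be the cone of this flag, where the Bergman class of `N` is
`1`. Let `N'` be a quotient of `M` of the same rank whose class is also nonzero at `σ`. The flag
consists of flats of `N'`, so counting ranks down from the top gives `rk_{N'} ≤ rk_N` on the flag.
Any flat `G` of `N` contains an `f`-cyclic flat `F` of equal nullity, and `F` is on the flag. As the
nullity of `N'` is monotone (`quotNullity_mono`), `rk_{N'}(G) ≤ rk_{N'}(F) + rk_M(G) - rk_M(F) ≤
rk_N(F) + rk_M(G) - rk_M(F) = rk_N(G)`. Passing to closures in `N` gives `rk_{N'} ≤ rk_N` everywhere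
(`exists_braidCone_natRk_le`). In a linear relation, take `N` with nonzero coefficient and least
total rank, and evaluate at `σ`: only the term of `N` survives. -/

/-! ### Rank functions of loopless matroids -/

theorem LooplessMatroid.isFlat_empty {E : Type*} (M : LooplessMatroid E) :
    M.toMatroid.IsFlat ∅ := by
  have := M.loopless
  rw [Matroid.isFlat_iff_closure_eq]
  exact M.toMatroid.loops_eq_empty

/-- Degrees are written as rank minus one with truncated subtraction; positivity of the rank makes
equal degrees mean equal ranks. -/
theorem natRk_univ_pos {E : Type*} [Finite E] [Nonempty E] (M : LooplessMatroid E) :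
    0 < M.toMatroid.natRk Set.univ := by
  have := natRk_lt M.toMatroid M.ground_eq M.isFlat_empty (Set.empty_ssubset.2 Set.univ_nonempty)
  omega

theorem natRk_empty {E : Type*} (M : Matroid E) : M.natRk ∅ = 0 := by
  simp [Matroid.natRk]

/-- A matroid is determined by its ground set and its rank function. -/
theorem eq_of_natRk_eq {E : Type*} [Finite E] {M N : Matroid E} (hE : M.E = N.E)
    (h : ∀ S, M.natRk S = N.natRk S) : M = N := by
  refine Matroid.ext_indep hE fun I _ => ?_
  rw [Matroid.indep_iff_eRk_eq_encard_of_finite (Set.toFinite I),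
    Matroid.indep_iff_eRk_eq_encard_of_finite (Set.toFinite I), ← coe_natRk, ← coe_natRk, h]

theorem LooplessMatroid.ext_natRk {E : Type*} [Finite E] {M N : LooplessMatroid E}
    (h : ∀ S, M.toMatroid.natRk S = N.toMatroid.natRk S) : M = N := by
  obtain ⟨M, hM, _⟩ := M
  obtain ⟨N, hN, _⟩ := N
  obtain rfl : M = N := eq_of_natRk_eq (hM.trans hN.symm) h
  rfl

theorem natRk_insert_le {E : Type*} [Finite E] (M : Matroid E) (x : E) (A : Set E) :
    M.natRk (insert x A) ≤ M.natRk A + 1 := by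
  have := M.eRk_insert_le_add_one x A
  rw [← coe_natRk, ← coe_natRk] at this
  exact_mod_cast this

theorem natRk_insert_of_mem_closure {E : Type*} (M : Matroid E) {x : E} {A : Set E}
    (h : x ∈ M.closure A) : M.natRk (insert x A) = M.natRk A := by
  rw [← natRk_closure, Matroid.closure_insert_eq_of_mem_closure h, natRk_closure]

/-! ### Nullity and `f`-cyclic flats -/

/-- The nullity of a quotient is monotone. -/
theorem quotNullity_mono {E : Type*} [Finite E] {M' M : Matroid E} (hE : M'.E = Set.univ)
    (hq : M'.IsQuotientOf M) {A B : Set E} (h : A ⊆ B) :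
    M'.quotNullity M A ≤ M'.quotNullity M B := by
  have hM : M.E = Set.univ := hq.ground_eq ▸ hE
  have key : ∀ C : Set E, M'.quotNullity M A ≤ M'.quotNullity M (A ∪ C) := by
    intro C
    induction C, Set.toFinite C using Set.Finite.induction_on with
    | empty => simp
    | @insert x C _ _ ih =>
      refine ih.trans ?_
      rw [Set.union_insert]
      set X := A ∪ C
      unfold Matroid.quotNullity
      by_cases hx : x ∈ M'.closure X
      · have h1 := natRk_insert_of_mem_closure M' hx
        have h2 := natRk_mono M (Set.subset_insert x X)
        omega
      -- The `M'`-closure of `X` is a flat of `M`, so it contains the `M`-closure. Hence an element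
      -- that raises the `M'`-rank also raises the `M`-rank.
      · have hx' : x ∉ M.closure X := fun hxM => hx <| by
          have hfl := hq.isFlat_of_isFlat _ (M'.isFlat_closure X)
          have hsub : X ⊆ M'.closure X := M'.subset_closure X (by simp [hE])
          exact hfl.closure ▸ M.closure_subset_closure hsub hxM
        have h1 := natRk_insert_le M' x X
        have h2 := natRk_insert M hM (M.isFlat_closure X) hx'
        rw [natRk_closure] at h2
        have h3 : M.natRk (insert x (M.closure X)) = M.natRk (insert x X) := by
          rw [← natRk_closure, Matroid.closure_insert_closure_eq_closure_insert, natRk_closure]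
        omega
  simpa [Set.union_eq_self_of_subset_left h] using key B

theorem Matroid.IsQuotCyclicFlat.isFlat {E : Type*} {M' M : Matroid E} {F : Set E}
    (h : M'.IsQuotCyclicFlat M F) : M'.IsFlat F := by
  unfold Matroid.IsQuotCyclicFlat at h
  exact h.prop.1

/-- Every flat of `M'` contains an `f`-cyclic flat of the same nullity. -/
theorem exists_isQuotCyclicFlat_subset {E : Type*} [Finite E] (M' M : Matroid E) {G : Set E}
    (hG : M'.IsFlat G) :
    ∃ F ⊆ G, M'.IsQuotCyclicFlat M F ∧ M'.quotNullity M F = M'.quotNullity M G := by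
  obtain ⟨F, hFG, hF⟩ := (Set.toFinite {H : Set E | M'.IsFlat H ∧
    M'.quotNullity M H = M'.quotNullity M G}).exists_le_minimal (a := G) ⟨hG, rfl⟩
  refine ⟨F, hFG, ?_, hF.prop.2⟩
  unfold Matroid.IsQuotCyclicFlat
  rw [hF.prop.2]
  exact hF

/-! ### Flags of flats and the cone attached to a relative nested quotient -/

/-- Every chain of flats extends to a complete flag of flats. -/
theorem exists_flag_of_isChain {E : Type*} [Fintype E] (M : LooplessMatroid E)
    (C₀ : Set (Finset E)) (hC₀ : IsChain (· ⊆ ·) C₀)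
    (hF₀ : ∀ S ∈ C₀, M.toMatroid.IsFlat (S : Set E)) :
    ∃ f : ℕ → Finset E,
      (∀ j ≤ M.toMatroid.natRk Set.univ,
        M.toMatroid.IsFlat (f j : Set E) ∧ M.toMatroid.natRk (f j : Set E) = j) ∧
      (∀ i ≤ M.toMatroid.natRk Set.univ, ∀ j ≤ M.toMatroid.natRk Set.univ,
        f i ⊆ f j ∨ f j ⊆ f i) ∧
      ∀ S ∈ C₀, f (M.toMatroid.natRk (S : Set E)) = S := by
  classical
  have hE := M.ground_eq
  have hempty := M.isFlat_empty
  set M := M.toMatroid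
  obtain ⟨C, hsub, hmax⟩ := (Set.toFinite {C : Set (Finset E) | IsChain (· ⊆ ·) C ∧
    ∀ S ∈ C, M.IsFlat (S : Set E)}).exists_le_maximal (a := C₀) ⟨hC₀, hF₀⟩
  obtain ⟨hC, hF⟩ := hmax.prop
  have hmem : ∀ G : Finset E, M.IsFlat (G : Set E) → (∀ S ∈ C, G ⊆ S ∨ S ⊆ G) → G ∈ C := by
    intro G hG hcmp
    refine hmax.le_of_ge (y := insert G C) ⟨hC.insert fun S hS _ => hcmp S hS, ?_⟩
      (Set.subset_insert _ _) (Set.mem_insert _ _)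
    rintro S (rfl | hS)
    exacts [hG, hF S hS]
  have h0 : ∅ ∈ C := hmem _ (by simpa using hempty) fun S _ => Or.inl (Finset.empty_subset S)
  have h1 : Finset.univ ∈ C :=
    hmem _ (by rw [Finset.coe_univ, ← hE]; exact M.ground_isFlat)
      fun S _ => Or.inr (Finset.subset_univ S)
  have hle : ∀ S ∈ C, ∀ T ∈ C, M.natRk (S : Set E) ≤ M.natRk (T : Set E) → S ⊆ T := by
    intro S hS T hT hr
    rcases hC.total hS hT with h | h
    · exact h
    · exact (Finset.coe_injective
        (eq_of_natRk_le M hE (hF T hT) (Finset.coe_subset.2 h) hr)).ge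
  have hex : ∀ j ≤ M.natRk Set.univ, ∃ S ∈ C, M.natRk (S : Set E) = j := by
    intro j hj
    -- If rank `j` were missing from the maximal chain, let `A` and `B` be its members next below
    -- and above that rank. The closure of `A` with a point of `B ∖ A` lies between them, so it
    -- belongs to the chain; its rank `rk A + 1` is then `j` or contradicts the choice of `A`.
    by_contra! hcon
    obtain ⟨A, ⟨hAC, hAj⟩, hA⟩ := Set.exists_max_image
      {S | S ∈ C ∧ M.natRk (S : Set E) < j} (fun S => M.natRk (S : Set E)) (Set.toFinite _)
      ⟨∅, h0, by
        have := hcon ∅ h0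
        rw [Finset.coe_empty, natRk_empty] at this ⊢
        omega⟩
    have hne : A ≠ Finset.univ := by
      rintro rfl
      rw [Finset.coe_univ] at hAj
      omega
    obtain ⟨B, ⟨hBC, hBj⟩, hB⟩ := Set.exists_min_image
      {S | S ∈ C ∧ j < M.natRk (S : Set E)} (fun S => M.natRk (S : Set E)) (Set.toFinite _)
      ⟨Finset.univ, h1, by
        have := hcon _ h1
        rw [Finset.coe_univ] at this ⊢
        omega⟩
    obtain ⟨x, hxB, hxA⟩ := Finset.exists_of_ssubset
      (ssubset_of_natRk_lt M (hC.total hAC hBC) (hAj.trans hBj))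
    have hAB := hle A hAC B hBC (hAj.trans hBj).le
    obtain ⟨G, hG⟩ : ∃ G : Finset E, (G : Set E) = M.closure (insert x (A : Set E)) :=
      ⟨(M.closure (insert x (A : Set E))).toFinset, by simp⟩
    have hAG : A ⊆ G := by
      rw [← Finset.coe_subset, hG]
      exact (Set.subset_insert _ _).trans (M.subset_closure _ (by simp [hE]))
    have hGB : G ⊆ B := by
      rw [← Finset.coe_subset, hG]
      exact (hF B hBC).closure ▸ M.closure_subset_closure
        (Set.insert_subset (by simpa using hxB) (Finset.coe_subset.2 hAB))
    have hGr : M.natRk (G : Set E) = M.natRk (A : Set E) + 1 := by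
      rw [hG, natRk_closure, natRk_insert M hE (hF A hAC) (by simpa using hxA)]
    have hGC : G ∈ C := by
      refine hmem G (hG ▸ M.isFlat_closure _) fun S hS => ?_
      rcases lt_or_gt_of_ne (hcon S hS) with h | h
      · exact Or.inr ((hle S hS A hAC (hA S ⟨hS, h⟩)).trans hAG)
      · exact Or.inl (hGB.trans (hle B hBC S hS (hB S ⟨hS, h⟩)))
    have h2 := hcon G hGC
    have h3 := hA G ⟨hGC, by omega⟩
    omega
  choose! f hfC hfr using hex
  refine ⟨f, fun j hj => ⟨hF _ (hfC j hj), hfr j hj⟩,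
    fun i hi j hj => hC.total (hfC i hi) (hfC j hj), fun S hS => ?_⟩
  have hr := hfr _ (natRk_mono M (Set.subset_univ (S : Set E)))
  have hf := hfC _ (natRk_mono M (Set.subset_univ (S : Set E)))
  exact (hle _ hf S (hsub hS) hr.le).antisymm (hle S (hsub hS) _ hf hr.ge)

/-- A relative nested quotient `N` of `M` of rank `d + 1` has a maximal cone in its Bergman fan such
that every quotient of `M` of rank `d + 1` whose Bergman fan contains that cone has a pointwise
smaller rank function. -/
theorem exists_braidCone_natRk_le {E : Type*} [Fintype E] [DecidableEq E] (M : Matroid E)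
    (N : LooplessMatroid E) (hN : N.toMatroid.IsRelativeNestedQuotientOf M) :
    ∃ σ : BraidCone E (N.toMatroid.natRk Set.univ - 1),
      (∀ S ∈ σ.rays, N.toMatroid.IsFlat (S : Set E)) ∧
      ∀ N' : LooplessMatroid E, N'.toMatroid.IsQuotientOf M →
        N'.toMatroid.natRk Set.univ = N.toMatroid.natRk Set.univ →
        (∀ S ∈ σ.rays, N'.toMatroid.IsFlat (S : Set E)) →
        ∀ S, N'.toMatroid.natRk S ≤ N.toMatroid.natRk S := by
  set R := N.toMatroid.natRk Set.univ with hR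
  obtain ⟨f, hf, hchain, hfC⟩ := exists_flag_of_isChain N
    {F : Finset E | N.toMatroid.IsQuotCyclicFlat M (F : Set E)}
    (fun S hS T hT hne => by
      simpa using hN.isChain_cyclicFlats hS hT (by simpa using hne))
    (fun S hS => Matroid.IsQuotCyclicFlat.isFlat hS)
  rw [← hR] at hf hchain
  have hfinj : Set.InjOn f (Finset.Icc 1 (R - 1) : Finset ℕ) := by
    intro i hi j hj hij
    simp only [Finset.coe_Icc, Set.mem_Icc] at hi hj
    rw [← (hf i (by omega)).2, hij, (hf j (by omega)).2]
  -- The flats of rank `0` and `R` are `∅` and `E`, which are not rays.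
  refine ⟨⟨(Finset.Icc 1 (R - 1)).image f, ?_, ?_, ?_⟩, ?_, ?_⟩
  · rw [Finset.card_image_of_injOn hfinj]
    simp
  · intro S hS
    obtain ⟨j, hj, rfl⟩ := Finset.mem_image.1 hS
    rw [Finset.mem_Icc] at hj
    have hr := (hf j (by omega)).2
    constructor
    · intro h
      rw [h, Finset.coe_empty, natRk_empty] at hr
      omega
    · intro h
      rw [h, Finset.coe_univ] at hr
      omega
  · intro S hS T hT _
    simp only [Finset.coe_image, Finset.coe_Icc, Set.mem_image, Set.mem_Icc] at hS hT
    obtain ⟨i, hi, rfl⟩ := hS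
    obtain ⟨j, hj, rfl⟩ := hT
    exact hchain i (by omega) j (by omega)
  · intro S hS
    obtain ⟨j, hj, rfl⟩ := Finset.mem_image.1 hS
    rw [Finset.mem_Icc] at hj
    exact (hf j (by omega)).1
  · intro N' hN' hrk hσ S
    have hfl : ∀ j < R, N'.toMatroid.IsFlat (f j : Set E) := by
      intro j hj
      rcases Nat.eq_zero_or_pos j with rfl | hj0
      · have := eq_of_natRk_le N.toMatroid N.ground_eq N.isFlat_empty
          (Set.empty_subset (f 0 : Set E)) (by rw [(hf 0 (by omega)).2]; omega)
        rw [← this]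
        exact N'.isFlat_empty
      · exact hσ _ (Finset.mem_image_of_mem f (Finset.mem_Icc.2 ⟨hj0, by omega⟩))
    -- Descend from the common rank `R`: each strict inclusion out of a flat of `N'` costs at least
    -- one rank.
    have hle : ∀ j ≤ R, N'.toMatroid.natRk (f j : Set E) ≤ j := by
      intro j hj
      induction hj using Nat.decreasingInduction with
      | self => exact (natRk_mono _ (Set.subset_univ _)).trans hrk.le
      | @of_succ j hj ih =>
        have hss := ssubset_of_natRk_lt N.toMatroid (hchain j (by omega) (j + 1) (by omega))
          (by rw [(hf j (by omega)).2, (hf (j + 1) (by omega)).2]; omega)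
        have := natRk_lt N'.toMatroid N'.ground_eq (hfl j hj) (Finset.coe_ssubset.2 hss)
        omega
    obtain ⟨F, hFG, hF, hnull⟩ := exists_isQuotCyclicFlat_subset N.toMatroid M
      (N.toMatroid.isFlat_closure S)
    have hFr : N'.toMatroid.natRk F ≤ N.toMatroid.natRk F := by
      -- Being `f`-cyclic, `F` is the member of the flag at index `rk_N(F)`.
      have h1 := hfC F.toFinite.toFinset (by simpa using hF)
      have h2 := hle _ (natRk_mono N.toMatroid (Set.subset_univ F))
      rw [Set.Finite.coe_toFinset] at h1
      rwa [h1, Set.Finite.coe_toFinset] at h2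
    have hmono := quotNullity_mono N'.ground_eq hN' hFG
    have hS := natRk_mono N'.toMatroid
      (N.toMatroid.subset_closure S (by simp [N.ground_eq]))
    have hcl := natRk_closure N.toMatroid S
    unfold Matroid.quotNullity at hmono hnull
    omega

/-! ### Evaluation on cones and linear independence -/

/-- The values of the homogeneous components of an element of `MW_•` on all cones. -/
noncomputable def minkowskiEval (E : Type*) [Fintype E] [DecidableEq E] :
    MinkowskiWeights E →ₗ[ℝ] (ℓ : ℕ) → BraidCone E ℓ → ℝ :=
  LinearMap.pi fun ℓ => (MinkowskiWeight E ℓ).subtype ∘ₗ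
    DirectSum.component ℝ ℕ (fun ℓ => MinkowskiWeight E ℓ) ℓ

theorem minkowskiEval_bergmanClass {E : Type*} [Fintype E] [DecidableEq E] (N : LooplessMatroid E) (ℓ : ℕ)
    (σ : BraidCone E ℓ) :
    minkowskiEval E (bergmanClass N) ℓ σ =
      if N.toMatroid.natRk Set.univ - 1 = ℓ then bergmanWeight N.toMatroid ℓ σ else 0 := by
  change ((bergmanClass N ℓ : MinkowskiWeight E ℓ) : BraidCone E ℓ → ℝ) σ = _
  unfold bergmanClass
  split_ifs with h
  · subst h
    rw [DirectSum.lof_apply]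
  · rw [DirectSum.lof_eq_of, DirectSum.of_eq_of_ne _ _ _ (Ne.symm h)]
    rfl

theorem mainTheorem11 (n : ℕ) (M : Matroid (Fin (n + 1))) (hM : M.E = Set.univ) :
    LinearIndependent ℝ
      (fun M' : {M' : LooplessMatroid (Fin (n + 1)) //
          M'.toMatroid.IsRelativeNestedQuotientOf M} => bergmanClass M'.1) := by
  classical
  refine LinearIndependent.of_comp (minkowskiEval (Fin (n + 1))) (linearIndependent_iff'.2 ?_)
  intro s g hsum
  by_contra! hcon
  obtain ⟨N, hN, hmin⟩ := Finset.exists_min_image (s.filter fun N => g N ≠ 0)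
    (fun N => ∑ S : Set (Fin (n + 1)), N.1.toMatroid.natRk S)
    (by simpa [Finset.Nonempty] using hcon)
  obtain ⟨hNs, hgN⟩ := Finset.mem_filter.1 hN
  obtain ⟨σ, hσ, hle⟩ := exists_braidCone_natRk_le M N.1 N.2
  generalize hd : N.1.toMatroid.natRk Set.univ - 1 = d at σ hσ hle
  have heval : ∑ N' ∈ s, g N' * minkowskiEval (Fin (n + 1)) (bergmanClass N'.1) d σ = 0 := by
    simpa using congrFun (congrFun hsum d) σ
  rw [Finset.sum_eq_single N] at heval
  · rw [minkowskiEval_bergmanClass, if_pos hd, bergmanWeight, if_pos hσ, mul_one] at heval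
    exact hgN heval
  · intro N' hN's hne
    by_cases hg : g N' = 0
    · rw [hg, zero_mul]
    rw [minkowskiEval_bergmanClass]
    split_ifs with hrk
    swap
    · exact mul_zero _
    rw [bergmanWeight, if_neg, mul_zero]
    -- A second surviving term would have a pointwise smaller rank function; minimality of the total
    -- rank then forces equality, hence the same matroid.
    intro hσ'
    have hpos := natRk_univ_pos N.1
    have hpos' := natRk_univ_pos N'.1
    have hr := hle N'.1 N'.2.isQuotientOf (by omega) hσ'
    have hsum_le := hmin N' (Finset.mem_filter.2 ⟨hN's, hg⟩)
    have heq := (Finset.sum_eq_sum_iff_of_le fun S _ => hr S).1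
      ((Finset.sum_le_sum fun S _ => hr S).antisymm hsum_le)
    exact hne (Subtype.ext (LooplessMatroid.ext_natRk fun S => heq S (Finset.mem_univ S)))
  · exact fun h => absurd hNs h
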